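/- Let $p$ be an odd prime and let $m,e$ be positive integers such that $m/\gcd(m,e)$ is odd. Put $q=p^m$, let $\mathrm{Tr}$ be the trace from $\mathrm{GF}(q)$ to $\mathrm{GF}(p)$, and let $$\mathcal C=\left\{\left(\mathrm{Tr}(a x^{p^e+1}+bx+c)\right)_{x\in \mathrm{GF}(q)} : a,b,c\in \mathrm{GF}(q)\right\},$$ a linear code over $\mathrm{GF}(p)$ whose coordinate positions are the elements of $\mathrm{GF}(q)$. Let $T=\mathrm{GF}(p)\subseteq \mathrm{GF}(q)$, and let $\mathcal C_T$ be the shortened code of $\mathcal C$ on $T$, that is, the code obtained from the codewords of $\mathcal C$ that are $0$ on $T$ by deleting the coordinates in $T$. Then $\mathcal C_T$ has length $p^m-p$ and dimension $2m-2$, and its weight distribution is as follows; weights not listed do not occur. If $m$ is odd, put $B=(-1)^{\frac{q-1}{2}+\frac{(p-1)(m-1)}{4}}\,p^{\frac{m-1}{2}}$ and $\varepsilon=(-1)^{\frac{(p-1)(m+1)}{4}}$. The weights and their multiplicities are - $0$, with multiplicity $1$; - $p^{m-1}(p-1)$, with multiplicity $(p^{m-1}-1)(p^{m-2}+1)$;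 - $p^{m-1}(p-1)-\varepsilon p^{\frac{m-1}{2}}$, with multiplicity $\frac{p^{m-1}-1}{2}(p-1)(p^{m-2}+B)$; - $p^{m-1}(p-1)+\varepsilon p^{\frac{m-1}{2}}$, with multiplicity $\frac{p^{m-1}-1}{2}(p-1)(p^{m-2}-B)$. If $m$ is even, put $\delta=(-1)^{\frac{m(p-1)}{4}}$, $$B_1=\frac{p^{m-1}-1-(p-1)p^{\frac{m-2}{2}}(\sqrt{-1})^{\frac{(p-1)m}{2}}}{2},\qquad B_2=(-1)^{\frac{q+1}{2}+\frac{m(p-1)}{4}}(p-1)p^{\frac{m-2}{2}}.$$ The weights and their multiplicities are - $0$, with multiplicity $1$; - $p^{m-1}(p-1)$, with multiplicity $p^{m-1}-1$; - $p^{m-1}(p-1)+\delta(p-1)p^{\frac{m-2}{2}}$, with multiplicity $B_1(p^{m-2}+B_2)$; - $p^{m-1}(p-1)-\delta(p-1)p^{\frac{m-2}{2}}$, with multiplicity $(p^{m-1}-1-B_1)(p^{m-2}-B_2)$; - $p^{m-1}(p-1)-\delta p^{\frac{m-2}{2}}$, with multiplicity $B_1(p^{m-1}-p^{m-2}-B_2)$;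 - $p^{m-1}(p-1)+\delta p^{\frac{m-2}{2}}$, with multiplicity $(p^{m-1}-1-B_1)(p^{m-1}-p^{m-2}+B_2)$. (A listed weight whose multiplicity is $0$ does not occur.) -/

import Mathlib

namespace ShortenedCodes

/-- A linear code over the field `K` whose coordinate positions are the elements of the finite
type `ι` is a subspace of `ι → K`; its dimension is `Module.finrank K C`.
This is its length, the number of coordinate positions. -/
def codeLength {K ι : Type*} [Field K] [Fintype ι] (_C : Submodule K (ι → K)) : ℕ :=
  Fintype.card ι

/-- `A_w`: the number of codewords of Hamming weight `w`. -/
noncomputable def weightCount {K ι : Type*} [Field K] [DecidableEq K] [Fintype ι]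
    (C : Submodule K (ι → K)) (w : ℕ) : ℕ :=
  Set.ncard {c : ι → K | c ∈ C ∧ hammingNorm c = w}

/-- The code `C(T)` of the codewords of `C` that are `0` on `T`. -/
def vanishingSubcode {K ι : Type*} [Field K] (C : Submodule K (ι → K)) (T : Finset ι) :
    Submodule K (ι → K) where
  carrier := {c | c ∈ C ∧ ∀ i ∈ T, c i = 0}
  add_mem' := by
    rintro c d ⟨hc, hc'⟩ ⟨hd, hd'⟩
    exact ⟨C.add_mem hc hd, fun i hi => by simp [hc' i hi, hd' i hi]⟩
  zero_mem' := ⟨C.zero_mem, fun _ _ => rfl⟩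
  smul_mem' := by
    rintro k c ⟨hc, hc'⟩
    exact ⟨C.smul_mem k hc, fun i hi => by simp [hc' i hi]⟩

/-- The punctured code `C^T`: the coordinates in `T` are deleted from every codeword. -/
def puncturedCode {K ι : Type*} [Field K] (C : Submodule K (ι → K)) (T : Finset ι) :
    Submodule K ({i : ι // i ∉ T} → K) :=
  C.map (LinearMap.funLeft K K (Subtype.val : {i : ι // i ∉ T} → ι))

/-- The shortened code `C_T`: puncture `C(T)` on `T`. -/
def shortenedCode {K ι : Type*} [Field K] (C : Submodule K (ι → K)) (T : Finset ι) :
    Submodule K ({i : ι // i ∉ T} → K) :=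
  puncturedCode (vanishingSubcode C T) T

/-- The code `{ (Tr(a f(x) + b x + c))_{x ∈ F} : a, b, c ∈ F }` over `K`, with coordinate positions
the elements of `F`, where `Tr` is the trace from `F` to `K`. -/
def traceCode (K : Type*) {F : Type*} [Field K] [Field F] [Algebra K F] (f : Polynomial F) :
    Submodule K (F → K) where
  carrier := {v | ∃ a b c : F, v = fun x => Algebra.trace K F (a * f.eval x + b * x + c)}
  add_mem' := by
    rintro _ _ ⟨a, b, c, rfl⟩ ⟨a', b', c', rfl⟩
    refine ⟨a + a', b + b', c + c', funext fun x => ?_⟩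
    rw [Pi.add_apply, ← map_add]
    congr 1
    ring
  zero_mem' := ⟨0, 0, 0, funext fun x => by simp⟩
  smul_mem' := by
    rintro k _ ⟨a, b, c, rfl⟩
    refine ⟨k • a, k • b, k • c, funext fun x => ?_⟩
    rw [Pi.smul_apply, ← map_smul]
    simp only [smul_add, smul_mul_assoc]

/-- The prime field `GF(p)`, as a set of elements of its extension `F`. -/
def primeField (p : ℕ) [Fact p.Prime] (F : Type*) [Field F] [Algebra (ZMod p) F]
    [DecidableEq F] : Finset F :=
  Finset.univ.image (algebraMap (ZMod p) F)

/-- The weight distribution of `C` is given by a table of rows (weight, multiplicity): for every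
`w`, the number of codewords of weight `w` is the multiplicity in the row of weight `w`, and `0` if
there is no such row. (Rows that share a weight would be added up.) -/
def HasWeightTable {K ι : Type*} [Field K] [DecidableEq K] [Fintype ι]
    (C : Submodule K (ι → K)) (table : List (ℤ × ℚ)) : Prop :=
  ∀ w : ℕ, (weightCount C w : ℚ) = ((table.filter fun row => row.1 = (w : ℤ)).map Prod.snd).sum

/-- `B = (-1)^{(q-1)/2 + (p-1)(m-1)/4} p^{(m-1)/2}`, where `q = p^m` (for `p`, `m` odd). -/
def constB (p m : ℕ) : ℚ :=
  (-1) ^ ((p ^ m - 1) / 2 + (p - 1) * (m - 1) / 4) * (p : ℚ) ^ ((m - 1) / 2)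

/-- `B₁ = (p^{m-1} - 1 - (p-1) p^{(m-2)/2} (√-1)^{(p-1)m/2}) / 2` (for `p` odd, `m` even). The
exponent `(p-1)m/2` is even, so the power of `√-1` is `(-1)^{(p-1)m/4}`. -/
def constB₁ (p m : ℕ) : ℚ :=
  ((p : ℚ) ^ (m - 1) - 1 - ((p : ℚ) - 1) * (p : ℚ) ^ ((m - 2) / 2) * (-1) ^ ((p - 1) * m / 4)) / 2

/-- `B₂ = (-1)^{(q+1)/2 + m(p-1)/4} (p-1) p^{(m-2)/2}`, where `q = p^m` (for `p` odd, `m` even). -/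
def constB₂ (p m : ℕ) : ℚ :=
  (-1) ^ ((p ^ m + 1) / 2 + m * (p - 1) / 4) * ((p : ℚ) - 1) * (p : ℚ) ^ ((m - 2) / 2)

/-- The table for `m` odd. All natural-number divisions are exact for `p`, `m` odd; the power
`p^{m-2}` is the rational number `1/p` for `m = 1`. -/
def tableOdd (p m : ℕ) : List (ℤ × ℚ) :=
  [(0, 1),
   ((p : ℤ) ^ (m - 1) * (p - 1),
      ((p : ℚ) ^ (m - 1) - 1) * ((p : ℚ) ^ ((m : ℤ) - 2) + 1)),
   ((p : ℤ) ^ (m - 1) * (p - 1) - (p : ℤ) ^ ((m - 1) / 2) * (-1) ^ ((p - 1) * (m + 1) / 4),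
      ((p : ℚ) ^ (m - 1) - 1) / 2 * ((p : ℚ) - 1) * ((p : ℚ) ^ ((m : ℤ) - 2) + constB p m)),
   ((p : ℤ) ^ (m - 1) * (p - 1) + (p : ℤ) ^ ((m - 1) / 2) * (-1) ^ ((p - 1) * (m + 1) / 4),
      ((p : ℚ) ^ (m - 1) - 1) / 2 * ((p : ℚ) - 1) * ((p : ℚ) ^ ((m : ℤ) - 2) - constB p m))]

/-- The table for `m` even. All natural-number divisions are exact for `p` odd, `m` even. -/
def tableEven (p m : ℕ) : List (ℤ × ℚ) :=
  [(0, 1),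
   ((p : ℤ) ^ (m - 1) * (p - 1),
      (p : ℚ) ^ (m - 1) - 1),
   ((p : ℤ) ^ (m - 1) * (p - 1)
        - (p - 1) * (p : ℤ) ^ ((m - 2) / 2) * (-1) ^ ((m * (p - 1) + 4) / 4),
      constB₁ p m * ((p : ℚ) ^ (m - 2) + constB₂ p m)),
   ((p : ℤ) ^ (m - 1) * (p - 1)
        - (p - 1) * (p : ℤ) ^ ((m - 2) / 2) * (-1) ^ (m * (p - 1) / 4),
      ((p : ℚ) ^ (m - 1) - 1 - constB₁ p m) * ((p : ℚ) ^ (m - 2) - constB₂ p m)),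
   ((p : ℤ) ^ (m - 1) * (p - 1) - (p : ℤ) ^ ((m - 2) / 2) * (-1) ^ (m * (p - 1) / 4),
      constB₁ p m * ((p : ℚ) ^ (m - 1) - (p : ℚ) ^ (m - 2) - constB₂ p m)),
   ((p : ℤ) ^ (m - 1) * (p - 1) - (p : ℤ) ^ ((m - 2) / 2) * (-1) ^ ((m * (p - 1) + 4) / 4),
      ((p : ℚ) ^ (m - 1) - 1 - constB₁ p m)
        * ((p : ℚ) ^ (m - 1) - (p : ℚ) ^ (m - 2) + constB₂ p m))]

end ShortenedCodes

/-! ### Value distribution of a nondegenerate quadratic form over `ZMod p`. -/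

namespace ShortenedCodes

open Finset

/-! On `GF(p)` the word of `(a, b, c)` is `t² Tr a + t Tr b + Tr c`, so it vanishes there iff all
three traces do. Hence `C_T` is parametrized by pairs `(a, b)` of trace zero, and weights may be
counted over all of `F`. For `a ≠ 0`, `Q(x) = Tr (a x^(p^e+1))` is a quadratic form whose bilinear
form `B` is nondegenerate because `m / gcd(m, e)` is odd. Writing `Tr (b x) = 2 B(y, x)` and
completing the square, the word has as many zeros as `Q` takes the value `Q(y)`. Moreover `Tr b = 0`
means `y ⊥ 1`, and `Q(1) = Tr a = 0`. Off the hyperplane `1^⊥`, translation along the isotropic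
vector `1` equidistributes `Q`, so its values on `1^⊥` follow from those on `F`
(`orthogonalValueCount_add`). The value counts of `Q` come without Gauss sums: they depend only on
the square class, and their first two moments lead to `z² + p v² = q`, which descent solves up to a
sign `σ`. For `m` odd, `σ` drops out on summing over `b`. For `m` even, the number of `a` with each
sign follows from double counting the pairs `(a, x)` with `Tr a = Tr (a x^(p^e+1)) = 0`. -/

/-- The solutions of `z ^ 2 + p * v ^ 2 = p ^ n` in integers. -/
theorem sq_add_mul_sq_eq_pow {p : ℕ} (hp : p.Prime) (n : ℕ) (z v : ℤ)
    (h : z ^ 2 + p * v ^ 2 = (p : ℤ) ^ n) :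
    (Even n → v = 0 ∧ z ^ 2 = (p : ℤ) ^ n) ∧ (Odd n → z = 0 ∧ p * v ^ 2 = (p : ℤ) ^ n) := by
  induction n generalizing z v with
  | zero =>
    refine ⟨fun _ => ?_, fun h => by simp at h⟩
    have hp2 : (2 : ℤ) ≤ p := by exact_mod_cast hp.two_le
    have hv : v = 0 := by
      by_contra hv
      have : 0 < v ^ 2 := by positivity
      nlinarith [sq_nonneg z]
    subst hv
    simpa using h
  | succ n ih =>
    have hp0 : (p : ℤ) ≠ 0 := by exact_mod_cast hp.ne_zero
    have hd : (p : ℤ) ∣ z := by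
      apply (Nat.prime_iff_prime_int.mp hp).dvd_of_dvd_pow (n := 2)
      exact ⟨(p : ℤ) ^ n - v ^ 2, by rw [pow_succ _ n] at h; linarith⟩
    obtain ⟨y, rfl⟩ := hd
    -- Descent: dividing by `p` exchanges the roles of the two unknowns and lowers the exponent by
    -- one.
    have h' : v ^ 2 + p * y ^ 2 = (p : ℤ) ^ n := by
      apply mul_left_cancel₀ hp0
      rw [pow_succ _ n] at h
      linarith
    obtain ⟨he, ho⟩ := ih v y h'
    refine ⟨fun hn => ?_, fun hn => ?_⟩
    · obtain ⟨h1, h2⟩ := ho (by simpa [Nat.even_add_one] using hn)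
      refine ⟨h1, ?_⟩
      rw [pow_succ _ n, ← h2]; ring
    · obtain ⟨h1, h2⟩ := he (by simpa [Nat.odd_add_one] using hn)
      refine ⟨by simp [h1], ?_⟩
      rw [pow_succ _ n, ← h2]; ring

theorem eq_sign_mul_of_sq_eq {x y : ℤ} (h : x ^ 2 = y ^ 2) :
    ∃ σ : ℤ, (σ = 1 ∨ σ = -1) ∧ x = σ * y := by
  rcases sq_eq_sq_iff_eq_or_eq_neg.mp h with h | h
  · exact ⟨1, Or.inl rfl, by simp [h]⟩
  · exact ⟨-1, Or.inr rfl, by simp [h]⟩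

variable {p : ℕ} [Fact p.Prime] {V : Type*} [AddCommGroup V] [Module (ZMod p) V] [Fintype V]

theorem card_fiber_linearMap (f : V →ₗ[ZMod p] ZMod p) (hf : f ≠ 0) (t : ZMod p) :
    p * #{v | f v = t} = Fintype.card V := by
  have hs : Function.Surjective f := LinearMap.surjective hf
  have h : ∀ s, #{v | f v = s} = #{v | f v = t} := fun s =>
    AddMonoidHom.card_fiber_eq_of_mem_range f.toAddMonoidHom (hs s) (hs t)
  have := Finset.card_eq_sum_card_fiberwise (s := (univ : Finset V)) (t := univ) (f := f)
    (fun _ _ => mem_univ _)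
  simp only [h, sum_const, card_univ, ZMod.card, smul_eq_mul] at this
  exact this.symm

/-- The number of vectors `x` with `B x x = t`. -/
def valueCount (B : LinearMap.BilinForm (ZMod p) V) (t : ZMod p) : ℕ :=
  #{x | B x x = t}

theorem sum_valueCount (B : LinearMap.BilinForm (ZMod p) V) :
    ∑ t, valueCount B t = Fintype.card V :=
  (Finset.card_eq_sum_card_fiberwise (s := (univ : Finset V)) (t := univ)
    (f := fun x => B x x) (fun _ _ => mem_univ _)).symm

theorem valueCount_sq_mul (B : LinearMap.BilinForm (ZMod p) V) {c : ZMod p} (hc : c ≠ 0)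
    (t : ZMod p) : valueCount B (c ^ 2 * t) = valueCount B t := by
  refine (Finset.card_nbij' (fun x => c • x) (fun x => c⁻¹ • x) ?_ ?_ ?_ ?_).symm
  · intro x hx
    simp only [coe_filter, mem_univ, true_and, Set.mem_ofPred_eq] at hx ⊢
    simp [hx]; ring
  · intro x hx
    simp only [coe_filter, mem_univ, true_and, Set.mem_ofPred_eq] at hx ⊢
    simp [hx]; field_simp
  · intro x _; simp [smul_smul, hc]
  · intro x _; simp [smul_smul, hc]

theorem two_ne_zero_of_odd (hp : Odd p) : (2 : ZMod p) ≠ 0 := by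
  intro h
  have : ((2 : ℕ) : ZMod p) = 0 := by exact_mod_cast h
  rw [ZMod.natCast_eq_zero_iff] at this
  have h3 := Nat.le_of_dvd two_pos this
  have h4 := (Fact.out : p.Prime).two_le
  obtain ⟨k, hk⟩ := hp
  omega

/-- The involution `x ↦ -x` has no fixed point on a nonzero level set. The parity makes the
parameters of `exists_valueCount_eq` integers. -/
theorem even_valueCount (hp : Odd p) (B : LinearMap.BilinForm (ZMod p) V) {t : ZMod p}
    (ht : t ≠ 0) : Even (valueCount B t) := by
  have h2 := two_ne_zero_of_odd hp
  have h : ∑ x ∈ ({x | B x x = t} : Finset V), (1 : ZMod 2) = 0 := by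
    refine Finset.sum_involution (fun x _ => -x) (fun _ _ => by decide) ?_ ?_ (fun x _ => neg_neg x)
    · intro x hx _ he
      simp only [mem_filter, mem_univ, true_and] at hx
      have hx2 : (2 : ZMod p) • x = 0 := by
        rw [two_smul]; nth_rewrite 1 [← he]; simp
      rcases smul_eq_zero.mp hx2 with h | h
      · exact h2 h
      · subst h; simp at hx; exact ht hx.symm
    · intro x hx
      simpa using hx
  simp only [sum_const, nsmul_eq_mul, mul_one] at h
  exact (ZMod.natCast_eq_zero_iff_even).mp h

theorem card_orthogonal_pairs (B : LinearMap.BilinForm (ZMod p) V)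
    (hn : ∀ x, (∀ y, B x y = 0) → x = 0) :
    (p : ℤ) * #{u : V × V | B u.1 u.2 = 0} =
      p * Fintype.card V + (Fintype.card V - 1) * Fintype.card V := by
  classical
  have h : #{u : V × V | B u.1 u.2 = 0} = ∑ x : V, #{y | B x y = 0} := by
    simp only [Finset.card_filter, ← Fintype.sum_prod_type']
  rw [h, ← Finset.add_sum_erase _ _ (mem_univ (0 : V))]
  push_cast
  rw [mul_add, mul_sum, sum_congr rfl (g := fun _ => (Fintype.card V : ℤ))]
  · simp [Finset.card_erase_of_mem, Nat.cast_sub Fintype.card_pos]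
  · intro x hx
    have : B x ≠ 0 := fun h0 => (Finset.ne_of_mem_erase hx) (hn x fun y => by simp [h0])
    exact_mod_cast card_fiber_linearMap (B x) this 0

/-- The sum counts pairs with `B x x = B y y`; since `B (x + y) (x - y) = B x x - B y y` and `2` is
invertible, these correspond to orthogonal pairs. -/
theorem sum_valueCount_sq (hp : Odd p) (B : LinearMap.BilinForm (ZMod p) V)
    (hs : ∀ x y, B x y = B y x) (hn : ∀ x, (∀ y, B x y = 0) → x = 0) :
    (p : ℤ) * ∑ t, (valueCount B t : ℤ) ^ 2 =
      p * Fintype.card V + (Fintype.card V - 1) * Fintype.card V := by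
  classical
  rw [← card_orthogonal_pairs B hn]
  have h2 := two_ne_zero_of_odd hp
  congr 1
  have h : #{u : V × V | B u.1 u.2 = 0} = #{u : V × V | B u.1 u.1 = B u.2 u.2} := by
    refine Finset.card_nbij' (fun u => (u.1 + u.2, u.1 - u.2))
      (fun u => ((2 : ZMod p)⁻¹ • (u.1 + u.2), (2 : ZMod p)⁻¹ • (u.1 - u.2))) ?_ ?_ ?_ ?_
    · rintro ⟨x, y⟩ hx
      simp only [coe_filter, mem_univ, true_and, Set.mem_ofPred_eq] at hx ⊢
      simp [hx, hs y x]
    · rintro ⟨x, y⟩ hx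
      simp only [coe_filter, mem_univ, true_and, Set.mem_ofPred_eq] at hx ⊢
      simp only [map_add, map_sub, map_smul, LinearMap.add_apply,
        LinearMap.smul_apply, smul_eq_mul, hs y x, hx]
      ring
    · rintro ⟨x, y⟩ _
      ext
      · simp [← two_smul (ZMod p), smul_smul, h2]
      · simp [← two_smul (ZMod p), smul_smul, h2]
    · rintro ⟨x, y⟩ _
      ext
      · simp [← smul_add, ← two_smul (ZMod p), smul_smul, h2]
      · simp only [← smul_sub, add_sub_sub_cancel, ← two_smul (ZMod p), smul_smul,
          inv_mul_cancel₀ h2, one_smul]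
  rw [h, Finset.card_eq_sum_card_fiberwise (t := univ) (f := fun u => B u.1 u.1)
    (fun _ _ => mem_univ _)]
  push_cast
  refine sum_congr rfl fun t _ => ?_
  rw [sq, valueCount, ← Nat.cast_mul, ← Finset.card_product]
  congr 2
  ext ⟨x, y⟩
  simp only [mem_product, mem_filter, mem_univ, true_and]
  constructor
  · rintro ⟨h1, h2⟩; exact ⟨h1.trans h2.symm, h1⟩
  · rintro ⟨h1, h2⟩; exact ⟨h2, h1 ▸ h2⟩

theorem sum_quadraticChar_sq :
    ∑ t : ZMod p, quadraticChar (ZMod p) t ^ 2 = (p : ℤ) - 1 := by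
  classical
  rw [← Finset.add_sum_erase _ _ (mem_univ (0 : ZMod p)), sum_congr rfl (g := fun _ => (1 : ℤ))]
  · simp [Finset.card_erase_of_mem, ZMod.card, Nat.cast_sub (Fact.out : p.Prime).one_le]
  · intro t ht
    exact quadraticChar_sq_one (Finset.ne_of_mem_erase ht)

theorem ringChar_zmod_ne_two (hp : Odd p) : ringChar (ZMod p) ≠ 2 := by
  rw [ZMod.ringChar_zmod_n]
  rintro rfl
  exact absurd hp (by decide)

/-- Scaling makes the count constant on each of the three classes: zero, nonzero squares,
nonsquares. Here `u + v` and `u - v` are the values on the last two, and `z` corrects the value at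
zero. -/
theorem exists_valueCount_eq (hp : Odd p) (B : LinearMap.BilinForm (ZMod p) V) :
    ∃ u v z : ℤ, ∀ t, (valueCount B t : ℤ) =
      u + quadraticChar (ZMod p) t * v + if t = 0 then z else 0 := by
  obtain ⟨n, hn⟩ := quadraticChar_exists_neg_one (ringChar_zmod_ne_two hp)
  have hn0 : n ≠ 0 := by rintro rfl; simp at hn
  obtain ⟨a, ha⟩ := even_valueCount hp B one_ne_zero
  obtain ⟨b, hb⟩ := even_valueCount hp B hn0
  refine ⟨a + b, a - b, valueCount B 0 - (a + b), fun t => ?_⟩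
  by_cases ht : t = 0
  · subst ht; simp
  rw [if_neg ht, add_zero]
  rcases quadraticChar_dichotomy ht with h | h
  · obtain ⟨c, hc⟩ := (quadraticChar_one_iff_isSquare ht).mp h
    have hc0 : c ≠ 0 := by rintro rfl; simp at hc; exact ht hc
    have := valueCount_sq_mul B hc0 1
    rw [mul_one, sq, ← hc, ha] at this
    rw [h, this]; push_cast; ring
  · have h1 : quadraticChar (ZMod p) (t * n⁻¹) = 1 := by
      have h2 : quadraticChar (ZMod p) (t * n⁻¹) * quadraticChar (ZMod p) n = -1 := by
        rw [← map_mul, inv_mul_cancel_right₀ hn0, h]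
      rw [hn] at h2
      linarith
    obtain ⟨c, hc⟩ := (quadraticChar_one_iff_isSquare (mul_ne_zero ht (inv_ne_zero hn0))).mp h1
    have hc0 : c ≠ 0 := by
      rintro rfl
      simp only [mul_zero] at hc
      exact mul_ne_zero ht (inv_ne_zero hn0) hc
    have := valueCount_sq_mul B hc0 n
    rw [sq, ← hc, inv_mul_cancel_right₀ hn0, hb] at this
    rw [h, this]; push_cast; ring

theorem valueCount_parameters (hp : Odd p) (B : LinearMap.BilinForm (ZMod p) V)
    (hs : ∀ x y, B x y = B y x) (hn : ∀ x, (∀ y, B x y = 0) → x = 0) :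
    ∃ u v z : ℤ, (∀ t, (valueCount B t : ℤ) =
      u + quadraticChar (ZMod p) t * v + if t = 0 then z else 0) ∧
      p * u + z = Fintype.card V ∧ z ^ 2 + p * v ^ 2 = Fintype.card V := by
  obtain ⟨u, v, z, h⟩ := exists_valueCount_eq hp B
  have hp2 : (2 : ℤ) ≤ p := by exact_mod_cast (Fact.out : p.Prime).two_le
  have hχ := quadraticChar_sum_zero (ringChar_zmod_ne_two hp)
  have h1 : (p : ℤ) * u + z = Fintype.card V := by
    rw [← sum_valueCount B]
    push_cast
    simp only [h, sum_add_distrib, ← sum_mul, hχ]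
    simp [ZMod.card]
  have h2 := sum_valueCount_sq hp B hs hn
  have h3 : ∑ t, (valueCount B t : ℤ) ^ 2 = p * u ^ 2 + (p - 1) * v ^ 2 + (2 * u * z + z ^ 2) := by
    have : ∀ t, (valueCount B t : ℤ) ^ 2 = u ^ 2 + quadraticChar (ZMod p) t * (2 * u * v) +
        quadraticChar (ZMod p) t ^ 2 * v ^ 2 + if t = 0 then 2 * u * z + z ^ 2 else 0 := by
      intro t
      rw [h]
      split_ifs with ht
      · subst ht; simp; ring
      · ring
    simp only [this, sum_add_distrib, ← sum_mul, hχ, sum_quadraticChar_sq]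
    simp [ZMod.card]
  refine ⟨u, v, z, h, h1, ?_⟩
  rw [h3, ← h1] at h2
  rw [← h1]
  -- Eliminating the second moment leaves the desired relation times `p - 1`.
  have : ((p : ℤ) - 1) * (z ^ 2 + p * v ^ 2) = (p - 1) * (p * u + z) := by linarith
  exact mul_left_cancel₀ (by linarith) this

theorem valueCount_odd_dim (hp : Odd p) (B : LinearMap.BilinForm (ZMod p) V)
    (hs : ∀ x y, B x y = B y x) (hn : ∀ x, (∀ y, B x y = 0) → x = 0) {k : ℕ}
    (hV : Fintype.card V = p ^ (2 * k + 1)) :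
    ∃ σ : ℤ, (σ = 1 ∨ σ = -1) ∧ ∀ t, (valueCount B t : ℤ) =
      p ^ (2 * k) + σ * quadraticChar (ZMod p) t * p ^ k := by
  obtain ⟨u, v, z, h, h1, h2⟩ := valueCount_parameters hp B hs hn
  have hp0 : (p : ℤ) ≠ 0 := by exact_mod_cast (Fact.out : p.Prime).ne_zero
  rw [hV] at h1 h2
  push_cast at h1 h2
  obtain ⟨rfl, hv⟩ := (sq_add_mul_sq_eq_pow Fact.out _ z v h2).2 ⟨k, rfl⟩
  obtain ⟨σ, hσ, rfl⟩ := eq_sign_mul_of_sq_eq (x := v) (y := (p : ℤ) ^ k) (by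
    apply mul_left_cancel₀ hp0
    rw [hv]; ring)
  refine ⟨σ, hσ, fun t => ?_⟩
  have hu : u = p ^ (2 * k) := by
    apply mul_left_cancel₀ hp0
    rw [add_zero] at h1
    rw [h1]; ring
  rw [h, hu]
  simp; ring

theorem valueCount_even_dim (hp : Odd p) (B : LinearMap.BilinForm (ZMod p) V)
    (hs : ∀ x y, B x y = B y x) (hn : ∀ x, (∀ y, B x y = 0) → x = 0) {k : ℕ}
    (hV : Fintype.card V = p ^ (2 * k + 2)) :
    ∃ σ : ℤ, (σ = 1 ∨ σ = -1) ∧ ∀ t, (valueCount B t : ℤ) =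
      p ^ (2 * k + 1) + σ * p ^ k * if t = 0 then (p : ℤ) - 1 else -1 := by
  obtain ⟨u, v, z, h, h1, h2⟩ := valueCount_parameters hp B hs hn
  have hp0 : (p : ℤ) ≠ 0 := by exact_mod_cast (Fact.out : p.Prime).ne_zero
  rw [hV] at h1 h2
  push_cast at h1 h2
  obtain ⟨rfl, hz⟩ := (sq_add_mul_sq_eq_pow Fact.out _ z v h2).1 ⟨k + 1, by ring⟩
  obtain ⟨σ, hσ, rfl⟩ := eq_sign_mul_of_sq_eq (x := z) (y := (p : ℤ) ^ (k + 1)) (by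
    rw [hz]; ring)
  refine ⟨σ, hσ, fun t => ?_⟩
  have hu : u = p ^ (2 * k + 1) - σ * p ^ k := by
    apply mul_left_cancel₀ hp0
    rw [eq_sub_of_add_eq h1]; ring
  rw [h, hu]
  split_ifs
  · ring
  · ring

/-- The number of vectors `y` orthogonal to `w` with `B y y = t`. -/
def orthogonalValueCount (B : LinearMap.BilinForm (ZMod p) V) (w : V) (t : ZMod p) : ℕ :=
  #{y | B w y = 0 ∧ B y y = t}

theorem orthogonalValueCount_add (hp : Odd p) (B : LinearMap.BilinForm (ZMod p) V)
    (hs : ∀ x y, B x y = B y x) {w : V} (hw : B w ≠ 0) (hww : B w w = 0) (t : ZMod p) :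
    (p : ℤ) ^ 2 * orthogonalValueCount B w t + (p - 1) * Fintype.card V =
      p ^ 2 * valueCount B t := by
  have h2 := two_ne_zero_of_odd hp
  have key : ∀ s t, #{y | B w y ≠ 0 ∧ B y y = s} ≤ #{y | B w y ≠ 0 ∧ B y y = t} := by
    intro s t
    -- As `w` is isotropic, adding `c • w` to `y` changes `B y y` by `2 c B w y` and leaves `B w y`
    -- alone; the coefficient is chosen to move the value from `s` to `t`.
    refine Finset.card_le_card_of_injOn (fun y => y + ((t - s) / (2 * B w y)) • w) ?_ ?_
    · intro y hy
      simp only [coe_filter, mem_univ, true_and, Set.mem_ofPred_eq] at hy ⊢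
      obtain ⟨h0, rfl⟩ := hy
      refine ⟨by simpa [hww] using h0, ?_⟩
      simp only [map_add, LinearMap.add_apply, map_smul, LinearMap.smul_apply, smul_eq_mul, hww,
        hs y w]
      field_simp
      ring
    · intro y _ y' _ h
      have h' : B w y = B w y' := by simpa [hww] using congrArg (B w) h
      simpa [h'] using h
  have hsplit : ∀ t, valueCount B t =
      orthogonalValueCount B w t + #{y | B w y ≠ 0 ∧ B y y = t} := by
    intro t
    rw [valueCount, ← Finset.card_filter_add_card_filter_not (p := fun y => B w y = 0),
      filter_filter, filter_filter, orthogonalValueCount]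
    simp only [and_comm, ne_eq]
  have hsum : p * #{y | B w y ≠ 0 ∧ B y y = t} = #{y | B w y ≠ 0} := by
    rw [Finset.card_eq_sum_card_fiberwise (s := ({y | B w y ≠ 0} : Finset V)) (t := univ)
      (f := fun y => B y y) (fun _ _ => mem_univ _)]
    simp only [filter_filter]
    rw [sum_congr rfl fun s _ => le_antisymm (key s t) (key t s)]
    simp [ZMod.card]
  have h3 := Finset.card_filter_add_card_filter_not (s := (univ : Finset V)) (p := fun y => B w y = 0)
  have h4 := card_fiber_linearMap (B w) hw 0
  rw [Finset.card_univ] at h3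
  rw [hsplit]
  zify at hsum h3 h4
  push_cast
  linear_combination (-(p : ℤ)) * hsum - (p : ℤ) * h3 + h4

end ShortenedCodes

/-! ### The trace form and its nondegeneracy. -/

namespace ShortenedCodes

open Finset

variable {p m e : ℕ} [Fact p.Prime] {F : Type*} [Field F] [Fintype F] [Algebra (ZMod p) F]

omit [Fintype F] in
theorem algebraMap_zmod_pow (c : ZMod p) (e : ℕ) :
    algebraMap (ZMod p) F c ^ p ^ e = algebraMap (ZMod p) F c := by
  rw [← map_pow, ZMod.pow_card_pow]

omit [Fintype F] in
theorem add_pow_prime_pow (x y : F) (e : ℕ) : (x + y) ^ p ^ e = x ^ p ^ e + y ^ p ^ e := by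
  have : CharP F p := charP_of_injective_algebraMap (algebraMap (ZMod p) F).injective p
  exact add_pow_char_pow x y p e

omit [Fintype F] in
theorem pow_prime_pow_injective (e : ℕ) : Function.Injective fun x : F => x ^ p ^ e := by
  have : CharP F p := charP_of_injective_algebraMap (algebraMap (ZMod p) F).injective p
  exact (iterateFrobenius F p e).injective

theorem trace_pow_prime_pow (x : F) (e : ℕ) :
    Algebra.trace (ZMod p) F (x ^ p ^ e) = Algebra.trace (ZMod p) F x := by
  induction e with
  | zero => simp
  | succ e ih =>
    rw [pow_succ, pow_mul, ← ih]
    have := Algebra.trace_eq_of_algEquiv (FiniteField.frobeniusAlgEquivOfAlgebraic (ZMod p) F)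
      (x ^ p ^ e)
    simpa [ZMod.card] using this

theorem eq_zero_of_trace_mul_eq_zero {x : F} (h : ∀ y, Algebra.trace (ZMod p) F (x * y) = 0) :
    x = 0 :=
  (traceForm_nondegenerate (ZMod p) F).1 x h

omit [Fact p.Prime] [Algebra (ZMod p) F] in
theorem pow_prime_pow_mul_eq_self (hF : Fintype.card F = p ^ m) (x : F) :
    x ^ p ^ (e * (m / m.gcd e)) = x := by
  obtain ⟨c, hc⟩ := Nat.gcd_dvd_right m e
  have : e * (m / m.gcd e) = m * c := by
    nth_rewrite 1 [hc]
    rw [mul_comm (m.gcd e) c, mul_assoc, Nat.mul_div_cancel' (Nat.gcd_dvd_left m e), mul_comm]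
  rw [this, pow_mul, ← hF, FiniteField.pow_card_pow]

omit [Fintype F] in
theorem two_ne_zero_of_algebra (hp : Odd p) : (2 : F) ≠ 0 := by
  have := (map_ne_zero (algebraMap (ZMod p) F)).mpr (two_ne_zero_of_odd hp)
  rwa [map_ofNat] at this

/-- Iterating `m / gcd(m, e)` times, an odd number, gives `-y`; but the exponent `e * (m / gcd(m,
e))` is a multiple of `m`, so it also gives `y`. -/
theorem eq_zero_of_pow_eq_neg (hp : Odd p) (hme : Odd (m / m.gcd e))
    (hF : Fintype.card F = p ^ m) {y : F} (hy : y ^ p ^ e = -y) : y = 0 := by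
  have h : ∀ j, y ^ p ^ (e * j) = (-1) ^ j * y := by
    intro j
    induction j with
    | zero => simp
    | succ j ih =>
      rw [mul_add, mul_one, pow_add, pow_mul, ih, mul_pow, hy, ← pow_mul, mul_comm j, pow_mul,
        (hp.pow).neg_one_pow, pow_succ]
      ring
  have h1 := h (m / m.gcd e)
  rw [pow_prime_pow_mul_eq_self hF, hme.neg_one_pow] at h1
  have h2 : 2 * y = 0 := by linear_combination h1
  exact (mul_eq_zero.mp h2).resolve_left (two_ne_zero_of_algebra hp)

omit [Fact p.Prime] [Algebra (ZMod p) F] in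
theorem pow_eq_self_of_pow_pow_eq (hme : Odd (m / m.gcd e))
    (hF : Fintype.card F = p ^ m) {x : F} (hx : (x ^ p ^ e) ^ p ^ e = x) : x ^ p ^ e = x := by
  have h : ∀ j, x ^ p ^ (e * (2 * j + 1)) = x ^ p ^ e := by
    intro j
    induction j with
    | zero => simp
    | succ j ih =>
      rw [show e * (2 * (j + 1) + 1) = e * (2 * j + 1) + e + e by ring, pow_add, pow_add, pow_mul,
        pow_mul, ih, hx]
  obtain ⟨j, hj⟩ := hme
  rw [← h j, ← hj, pow_prime_pow_mul_eq_self hF]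

/-- The symmetric bilinear form with `B x x = Tr (a * x ^ (p ^ e + 1))`. -/
noncomputable def traceFormOf (p e : ℕ) [Fact p.Prime] {F : Type*} [Field F] [Algebra (ZMod p) F]
    [Fintype F] (a : F) : LinearMap.BilinForm (ZMod p) F :=
  LinearMap.mk₂ (ZMod p)
    (fun x y => Algebra.trace (ZMod p) F (a / 2 * (x ^ p ^ e * y + x * y ^ p ^ e)))
    (fun x x' y => by rw [← map_add, add_pow_prime_pow]; congr 1; ring)
    (fun c x y => by
      rw [← map_smul]
      congr 1
      simp only [Algebra.smul_def, mul_pow, algebraMap_zmod_pow]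
      ring)
    (fun x y y' => by rw [← map_add, add_pow_prime_pow]; congr 1; ring)
    (fun c x y => by
      rw [← map_smul]
      congr 1
      simp only [Algebra.smul_def, mul_pow, algebraMap_zmod_pow]
      ring)

theorem traceFormOf_apply (a x y : F) : traceFormOf p e a x y =
    Algebra.trace (ZMod p) F (a / 2 * (x ^ p ^ e * y + x * y ^ p ^ e)) := rfl

theorem traceFormOf_comm (a x y : F) : traceFormOf p e a x y = traceFormOf p e a y x := by
  rw [traceFormOf_apply, traceFormOf_apply]
  congr 1
  ring

theorem traceFormOf_self (hp : Odd p) (a x : F) :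
    traceFormOf p e a x x = Algebra.trace (ZMod p) F (a * x ^ (p ^ e + 1)) := by
  have := two_ne_zero_of_algebra (F := F) hp
  rw [traceFormOf_apply]
  congr 1
  field_simp
  ring

/-- Moving Frobenius across the trace turns the radical into the equation `b^(p^e) x^(p^(2e)) + b x
= 0` with `b = a / 2`. Multiplied by `x^(p^e)`, it says that `b x^(p^e+1)` is negated by the
`p^e`-th power. -/
theorem traceFormOf_nondegenerate (hp : Odd p) (hme : Odd (m / m.gcd e))
    (hF : Fintype.card F = p ^ m) {a : F} (ha : a ≠ 0) (x : F)
    (hx : ∀ y, traceFormOf p e a x y = 0) : x = 0 := by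
  have h2 := two_ne_zero_of_algebra (F := F) hp
  set b := a / 2 with hb
  have hb0 : b ≠ 0 := div_ne_zero ha h2
  have h0 : b ^ p ^ e * (x ^ p ^ e) ^ p ^ e + b * x = 0 := by
    apply eq_zero_of_trace_mul_eq_zero (p := p)
    intro z
    obtain ⟨y, rfl⟩ := (Finite.injective_iff_surjective.mp (pow_prime_pow_injective (p := p) e)) z
    rw [← hx y, traceFormOf_apply, ← hb, mul_add, map_add, ← trace_pow_prime_pow (b * (x ^ p ^ e * y)) e,
      ← map_add]
    congr 1
    ring
  have h1 : b * x ^ (p ^ e + 1) = 0 := by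
    apply eq_zero_of_pow_eq_neg hp hme hF
    rw [pow_succ, mul_pow, mul_pow]
    linear_combination x ^ p ^ e * h0
  simpa [hb0] using h1

/-- Both the trace form and `B` are nondegenerate; the bijection `b = f y` supplies the center for
completing the square. -/
theorem exists_trace_mul_eq (hp : Odd p) (hme : Odd (m / m.gcd e))
    (hF : Fintype.card F = p ^ m) {a : F} (ha : a ≠ 0) :
    ∃ f : F ≃ F, ∀ y x, Algebra.trace (ZMod p) F (f y * x) = 2 * traceFormOf p e a y x := by
  have h : ∀ y, ∃ b : F, ∀ x,
      Algebra.trace (ZMod p) F (b * x) = 2 * traceFormOf p e a y x := by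
    intro y
    have hnd := traceForm_nondegenerate (ZMod p) F
    refine ⟨(LinearMap.BilinForm.toDual _ hnd).symm ((2 : ZMod p) • traceFormOf p e a y),
      fun x => ?_⟩
    exact LinearMap.BilinForm.apply_toDual_symm_apply (hB := hnd) _ x
  choose f hf using h
  have hinj : Function.Injective f := by
    intro y y' hy
    rw [← sub_eq_zero]
    apply traceFormOf_nondegenerate hp hme hF ha
    intro x
    have h1 : 2 * traceFormOf p e a y x = 2 * traceFormOf p e a y' x := by
      rw [← hf, ← hf, hy]
    rw [map_sub, LinearMap.sub_apply, sub_eq_zero]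
    exact mul_left_cancel₀ (two_ne_zero_of_odd hp) h1
  exact ⟨Equiv.ofBijective f (Finite.injective_iff_bijective.mp hinj), hf⟩

theorem trace_ne_zero_linearMap : Algebra.trace (ZMod p) F ≠ 0 :=
  Algebra.trace_ne_zero _ _

variable [DecidableEq F]

/-- The elements of trace `0`. -/
noncomputable def traceZero (p : ℕ) [Fact p.Prime] (F : Type*) [Field F] [Fintype F]
    [Algebra (ZMod p) F] : Finset F :=
  {a | Algebra.trace (ZMod p) F a = 0}

omit [DecidableEq F] in
theorem mem_traceZero {a : F} : a ∈ traceZero p F ↔ Algebra.trace (ZMod p) F a = 0 := by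
  simp [traceZero]

/-- The condition is equivalent to `x² ∈ GF(p)`. As `m` is even, every element of `GF(p)` is a
square in `F`, which gives `1 + 2 (p - 1)` solutions. -/
theorem card_pow_mem_range (hp : Odd p) (hm : Even m) (hme : Odd (m / m.gcd e))
    (hF : Fintype.card F = p ^ m) :
    #{x : F | x ^ (p ^ e + 1) ∈ Set.range (algebraMap (ZMod p) F)} = 2 * p - 1 := by
  classical
  have hinj := (algebraMap (ZMod p) F).injective
  have hp1 := (Fact.out : p.Prime).one_lt
  have h2 : ringChar F ≠ 2 := by
    intro h
    have := two_ne_zero_of_algebra (F := F) hp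
    have h' : ((2 : ℕ) : F) = 0 := (ringChar.spec F 2).mpr (by rw [h])
    exact this (by exact_mod_cast h')
  have he : Even e := by
    by_contra he
    rw [Nat.not_even_iff_odd] at he
    have hg : Odd (m.gcd e) := he.of_dvd_nat (Nat.gcd_dvd_right m e)
    have := Nat.mul_div_cancel' (Nat.gcd_dvd_left m e)
    exact (Nat.not_even_iff_odd.mpr (this ▸ hg.mul hme)) hm
  have hset : ∀ x : F, x ^ (p ^ e + 1) ∈ Set.range (algebraMap (ZMod p) F) ↔
      x ^ 2 ∈ Set.range (algebraMap (ZMod p) F) := by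
    intro x
    constructor
    · rintro ⟨c, hc⟩
      by_cases hx : x = 0
      · exact ⟨0, by simp [hx]⟩
      have h1 : (x ^ p ^ e) ^ p ^ e * x ^ p ^ e = x * x ^ p ^ e := by
        rw [← mul_pow, ← pow_succ, ← hc, algebraMap_zmod_pow, hc, pow_succ, mul_comm]
      have h3 := pow_eq_self_of_pow_pow_eq hme hF (mul_right_cancel₀ (pow_ne_zero _ hx) h1)
      exact ⟨c, by rw [hc, pow_succ, h3, sq]⟩
    · rintro ⟨c, hc⟩
      have h1 : (x ^ p) ^ p = x := by
        have h3 : (x ^ p) ^ 2 = x ^ 2 := by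
          have := algebraMap_zmod_pow (F := F) c 1
          rw [hc, pow_one] at this
          rw [← pow_mul, mul_comm, pow_mul, this]
        rcases sq_eq_sq_iff_eq_or_eq_neg.mp h3 with h | h
        · rw [h, h]
        · rw [h, hp.neg_pow, h, neg_neg]
      -- `x^p = ±x` makes `x` a fixed point of the `p²`-power map, and `e` is even.
      have h4 : x ^ p ^ e = x := by
        clear hme
        obtain ⟨j, rfl⟩ := he
        induction j with
        | zero => simp
        | succ j ih =>
          rw [show j + 1 + (j + 1) = 1 + 1 + (j + j) by ring, pow_add, pow_mul, pow_add, pow_mul,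
            pow_one, h1, ih]
      exact ⟨c, by rw [hc, pow_succ _ (p ^ e), h4, sq]⟩
  have hsq : ∀ c : ZMod p, c ≠ 0 → IsSquare (algebraMap (ZMod p) F c) := by
    intro c hc
    rw [FiniteField.isSquare_iff h2 ((map_ne_zero _).mpr hc), hF, ← map_pow]
    obtain ⟨j, rfl⟩ := hm
    obtain ⟨r, hr⟩ : p ^ 2 - 1 ∣ (p ^ 2) ^ j - 1 := by
      simpa using Nat.sub_dvd_pow_sub_pow (p ^ 2) 1 j
    obtain ⟨s, rfl⟩ := hp
    -- This exhibits `p - 1 = 2 s` as a divisor of `(q - 1) / 2`, so Euler's criterion holds for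
    -- every nonzero `c`.
    have h3 : (2 * s + 1) ^ (j + j) = 2 * (2 * s * ((s + 1) * r)) + 1 := by
      have h5 : 0 < ((2 * s + 1) ^ 2) ^ j := by positivity
      have h6 : (2 * s + 1) ^ 2 - 1 = 4 * s * (s + 1) := by
        rw [Nat.sub_eq_iff_eq_add (Nat.one_le_pow _ _ (by omega))]; ring
      rw [h6] at hr
      rw [← two_mul, pow_mul]
      calc ((2 * s + 1) ^ 2) ^ j = 4 * s * (s + 1) * r + 1 := by omega
        _ = _ := by ring
    rw [h3, show (2 * (2 * s * ((s + 1) * r)) + 1) / 2 = 2 * s * ((s + 1) * r) by omega, pow_mul]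
    have := ZMod.pow_card_sub_one_eq_one hc
    rw [Nat.add_sub_cancel] at this
    rw [this, one_pow, map_one]
  have hcard : ∀ c : ZMod p, #{x : F | x ^ 2 = algebraMap (ZMod p) F c} =
      if c = 0 then 1 else 2 := by
    intro c
    have h := quadraticChar_card_sqrts h2 (algebraMap (ZMod p) F c)
    rw [Set.toFinset_ofPred] at h
    split_ifs with hc
    · subst hc
      simpa using h
    · rw [(quadraticChar_one_iff_isSquare ((map_ne_zero _).mpr hc)).mpr (hsq c hc)] at h
      exact_mod_cast h
  have hU : ({x : F | x ^ (p ^ e + 1) ∈ Set.range (algebraMap (ZMod p) F)} : Finset F) =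
      univ.biUnion fun c => ({x : F | x ^ 2 = algebraMap (ZMod p) F c} : Finset F) := by
    ext x
    simp only [mem_filter, mem_univ, true_and, mem_biUnion, hset, Set.mem_range, eq_comm]
  rw [hU, card_biUnion, sum_congr rfl fun c _ => hcard c]
  · rw [← add_sum_erase _ _ (mem_univ (0 : ZMod p)), sum_congr rfl (g := fun _ => 2)
      (fun c hc => if_neg (ne_of_mem_erase hc))]
    simp [card_erase_of_mem, ZMod.card]
    omega
  · intro c _ d _ hcd
    rw [Function.onFun, disjoint_left]
    intro x hx hx'
    simp only [mem_filter, mem_univ, true_and] at hx hx'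
    exact hcd (hinj (hx.symm.trans hx'))

end ShortenedCodes

/-! ### The shortened code and its weights through value counts. -/

namespace ShortenedCodes

open Finset

variable {p m e : ℕ} [Fact p.Prime] {F : Type*} [Field F] [Fintype F] [Algebra (ZMod p) F]

theorem card_mul_traceZero : p * #(traceZero p F) = Fintype.card F :=
  card_fiber_linearMap _ trace_ne_zero_linearMap 0

/-- If `Tr (· c)` vanished on the kernel of `Tr`, it would be a scalar multiple `l Tr`, and
nondegeneracy would give `c = l`. -/
theorem card_traceZero_filter_of_notMem {c : F} (hc : c ∉ Set.range (algebraMap (ZMod p) F)) :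
    p ^ 2 * #{a ∈ traceZero p F | Algebra.trace (ZMod p) F (a * c) = 0} = Fintype.card F := by
  classical
  let T := LinearMap.ker (Algebra.trace (ZMod p) F)
  let f : T →ₗ[ZMod p] ZMod p :=
    ((Algebra.trace (ZMod p) F).comp (LinearMap.mulRight (ZMod p) c)).comp T.subtype
  have hf : f ≠ 0 := by
    intro h0
    obtain ⟨a₀, ha₀⟩ := LinearMap.surjective (trace_ne_zero_linearMap (p := p) (F := F)) 1
    set l := Algebra.trace (ZMod p) F (a₀ * c) with hl
    refine hc ⟨l, ?_⟩
    rw [eq_comm, ← sub_eq_zero]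
    apply eq_zero_of_trace_mul_eq_zero (p := p)
    intro a
    have h1 : a - Algebra.trace (ZMod p) F a • a₀ ∈ T := by
      simp [T, ha₀]
    have h2 : Algebra.trace (ZMod p) F ((a - Algebra.trace (ZMod p) F a • a₀) * c) = 0 :=
      LinearMap.congr_fun h0 ⟨_, h1⟩
    rw [sub_mul, smul_mul_assoc, map_sub, map_smul, ← hl, smul_eq_mul] at h2
    rw [sub_mul, map_sub, ← Algebra.smul_def, map_smul, smul_eq_mul, mul_comm c, mul_comm l, h2]
  have h1 : #{a ∈ traceZero p F | Algebra.trace (ZMod p) F (a * c) = 0} = #{v | f v = 0} := by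
    symm
    refine card_bij (fun (v : T) _ => (v : F)) ?_ ?_ ?_
    · intro v hv
      simp only [mem_filter, mem_univ, true_and] at hv
      exact mem_filter.mpr ⟨mem_traceZero.mpr v.2, hv⟩
    · exact fun v _ w _ h => Subtype.ext h
    · intro a ha
      obtain ⟨h1, h2⟩ := mem_filter.mp ha
      exact ⟨⟨a, mem_traceZero.mp h1⟩, mem_filter.mpr ⟨mem_univ _, h2⟩, rfl⟩
  have h2 : Fintype.card T = #(traceZero p F) := by
    rw [Fintype.card_subtype]
    congr 1
    ext a
    simp [T, mem_traceZero]
  rw [h1, sq, mul_assoc, card_fiber_linearMap f hf, h2, card_mul_traceZero]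

theorem sum_card_trace_mul_eq_zero [DecidableEq F] (hp : Odd p) (hm : Even m)
    (hme : Odd (m / m.gcd e)) (hF : Fintype.card F = p ^ m) :
    (p : ℤ) ^ 2 * ∑ a ∈ traceZero p F,
      (#{x : F | Algebra.trace (ZMod p) F (a * x ^ (p ^ e + 1)) = 0} : ℤ) =
      (2 * p - 1) * (p * p ^ m) + (p ^ m - (2 * p - 1)) * p ^ m := by
  classical
  have hswap : ∑ a ∈ traceZero p F,
      #{x : F | Algebra.trace (ZMod p) F (a * x ^ (p ^ e + 1)) = 0} =
      ∑ x : F, #{a ∈ traceZero p F | Algebra.trace (ZMod p) F (a * x ^ (p ^ e + 1)) = 0} := by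
    simp only [card_filter]
    exact sum_comm
  rw [← Nat.cast_sum, hswap, Nat.cast_sum, mul_sum]
  have hone := (Fact.out : p.Prime).one_le
  have hval : ∀ x : F, (p : ℤ) ^ 2 *
      (#{a ∈ traceZero p F | Algebra.trace (ZMod p) F (a * x ^ (p ^ e + 1)) = 0} : ℤ) =
      if x ^ (p ^ e + 1) ∈ Set.range (algebraMap (ZMod p) F) then (p : ℤ) * p ^ m else p ^ m := by
    intro x
    split_ifs with hx
    · obtain ⟨c, hc⟩ := hx
      rw [filter_true_of_mem, sq, mul_assoc]
      · congr 1
        rw [← Nat.cast_mul, card_mul_traceZero, hF]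
        push_cast; rfl
      · intro a ha
        rw [← hc, mul_comm, ← Algebra.smul_def, map_smul, mem_traceZero.mp ha, smul_zero]
    · have := card_traceZero_filter_of_notMem hx
      rw [hF] at this
      exact_mod_cast this
  rw [sum_congr rfl fun x _ => hval x, sum_ite, sum_const, sum_const, nsmul_eq_mul, nsmul_eq_mul]
  have h1 := card_pow_mem_range hp hm hme hF
  have h2 := card_filter_add_card_filter_not (s := (univ : Finset F))
    (p := fun x => x ^ (p ^ e + 1) ∈ Set.range (algebraMap (ZMod p) F))
  have h3 : (#{x : F | x ^ (p ^ e + 1) ∈ Set.range (algebraMap (ZMod p) F)} : ℤ) = 2 * p - 1 := by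
    rw [h1]; push_cast [Nat.cast_sub (show 1 ≤ 2 * p by omega)]; rfl
  rw [card_univ, hF] at h2
  zify at h2
  rw [eq_sub_of_add_eq' h2, h3]

/-- The word `(Tr (a * x ^ (p ^ e + 1) + b * x))` with coordinate positions outside the prime
field, for `a` and `b` of trace zero. -/
noncomputable def traceWord (p e : ℕ) [Fact p.Prime] (F : Type*) [Field F] [Fintype F]
    [DecidableEq F] [Algebra (ZMod p) F] :
    (LinearMap.ker (Algebra.trace (ZMod p) F) × LinearMap.ker (Algebra.trace (ZMod p) F))
      →ₗ[ZMod p] ({x : F // x ∉ primeField p F} → ZMod p) where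
  toFun u x := Algebra.trace (ZMod p) F (u.1 * (x : F) ^ (p ^ e + 1) + u.2 * x)
  map_add' u v := by
    funext x
    rw [Pi.add_apply, ← map_add]
    congr 1
    simp
    ring
  map_smul' c u := by
    funext x
    rw [Pi.smul_apply, RingHom.id_apply, ← map_smul]
    congr 1
    simp

variable [DecidableEq F]

omit [Fintype F] in
theorem trace_word_primeField {a b x : F} (ha : Algebra.trace (ZMod p) F a = 0)
    (hb : Algebra.trace (ZMod p) F b = 0) (hx : x ∈ primeField p F) :
    Algebra.trace (ZMod p) F (a * x ^ (p ^ e + 1) + b * x) = 0 := by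
  obtain ⟨c, -, rfl⟩ := mem_image.mp hx
  rw [← map_pow, map_add, mul_comm a, mul_comm b, ← Algebra.smul_def, ← Algebra.smul_def, map_smul,
    map_smul, ha, hb, smul_zero, smul_zero, add_zero]

theorem shortenedCode_eq_range (hp : Odd p) :
    shortenedCode (traceCode (ZMod p) (Polynomial.X ^ (p ^ e + 1) : Polynomial F))
      (primeField p F) = LinearMap.range (traceWord p e F) := by
  have h2 := two_ne_zero_of_odd hp
  ext v
  constructor
  · rintro ⟨_, ⟨⟨a, b, c, rfl⟩, hT⟩, rfl⟩
    have h : ∀ t : ZMod p, t ^ 2 * Algebra.trace (ZMod p) F a + t * Algebra.trace (ZMod p) F b +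
        Algebra.trace (ZMod p) F c = 0 := by
      intro t
      have := hT (algebraMap (ZMod p) F t) (mem_image_of_mem _ (mem_univ _))
      rw [← this]
      simp only [Polynomial.eval_pow, Polynomial.eval_X]
      rw [pow_succ _ (p ^ e), algebraMap_zmod_pow, ← map_mul, map_add, map_add, mul_comm a, mul_comm b, ← Algebra.smul_def,
        ← Algebra.smul_def, map_smul, map_smul, smul_eq_mul, smul_eq_mul, sq]
    -- The points `0, 1, -1` determine a polynomial of degree two in odd characteristic.
    have hc : Algebra.trace (ZMod p) F c = 0 := by simpa using h 0
    have h1 := h 1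
    have h3 := h (-1)
    rw [hc] at h1 h3
    have ha : Algebra.trace (ZMod p) F a = 0 :=
      (mul_eq_zero.mp (show 2 * Algebra.trace (ZMod p) F a = 0 by
        linear_combination h1 + h3)).resolve_left h2
    have hb : Algebra.trace (ZMod p) F b = 0 := by
      rw [ha] at h1
      linear_combination h1
    refine ⟨(⟨a, ha⟩, ⟨b, hb⟩), funext fun x => ?_⟩
    simp [traceWord, hc, LinearMap.funLeft_apply]
  · rintro ⟨⟨⟨a, ha⟩, ⟨b, hb⟩⟩, rfl⟩
    refine ⟨fun x => Algebra.trace (ZMod p) F (a * x ^ (p ^ e + 1) + b * x),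
      ⟨⟨a, b, 0, ?_⟩, fun x hx => trace_word_primeField ha hb hx⟩, rfl⟩
    simp

/-- For a zero word, `Q` is additive, so polarization puts `1` in the radical of `B`; this forces `a
= 0`. -/
theorem traceWord_injective (hp : Odd p) (hme : Odd (m / m.gcd e))
    (hF : Fintype.card F = p ^ m) : Function.Injective (traceWord p e F) := by
  rw [injective_iff_map_eq_zero]
  rintro ⟨⟨a, ha⟩, ⟨b, hb⟩⟩ h
  have h0 : ∀ x : F, Algebra.trace (ZMod p) F (a * x ^ (p ^ e + 1) + b * x) = 0 := by
    intro x
    by_cases hx : x ∈ primeField p F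
    · exact trace_word_primeField ha hb hx
    · exact congrFun h ⟨x, hx⟩
  have ha0 : a = 0 := by
    by_contra ha0
    refine one_ne_zero (traceFormOf_nondegenerate hp hme hF ha0 1 fun y => ?_)
    have hQ : ∀ x, traceFormOf p e a x x = -Algebra.trace (ZMod p) F (b * x) := fun x => by
      rw [traceFormOf_self hp, eq_neg_iff_add_eq_zero, ← map_add, h0]
    have h1 := hQ (1 + y)
    rw [mul_add, map_add, map_add, map_add, LinearMap.add_apply, LinearMap.add_apply, hQ, hQ,
      traceFormOf_comm a y 1] at h1
    refine (mul_eq_zero.mp (?_ : 2 * traceFormOf p e a 1 y = 0)).resolve_left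
      (two_ne_zero_of_odd hp)
    linear_combination h1
  subst ha0
  have hb0 : b = 0 := eq_zero_of_trace_mul_eq_zero (p := p) fun y => by simpa using h0 y
  subst hb0
  rfl

omit [DecidableEq F] in
theorem finrank_ker_trace (hF : Fintype.card F = p ^ m) :
    Module.finrank (ZMod p) (LinearMap.ker (Algebra.trace (ZMod p) F)) = m - 1 := by
  have h1 := LinearMap.finrank_range_add_finrank_ker (Algebra.trace (ZMod p) F)
  rw [LinearMap.range_eq_top.mpr (LinearMap.surjective trace_ne_zero_linearMap), finrank_top,
    Module.finrank_self] at h1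
  have h2 := Module.card_eq_pow_finrank (K := ZMod p) (V := F)
  rw [hF, ZMod.card] at h2
  have h3 := Nat.pow_right_injective (Fact.out : p.Prime).two_le h2
  omega

/-- The weight of the word `(Tr (a * x ^ (p ^ e + 1) + b * x))` with coordinate positions `F`. -/
noncomputable def wordWeight (p e : ℕ) [Fact p.Prime] {F : Type*} [Field F] [Fintype F]
    [Algebra (ZMod p) F] (a b : F) : ℕ :=
  #{x : F | Algebra.trace (ZMod p) F (a * x ^ (p ^ e + 1) + b * x) ≠ 0}

theorem hammingNorm_traceWord
    (u : LinearMap.ker (Algebra.trace (ZMod p) F) × LinearMap.ker (Algebra.trace (ZMod p) F)) :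
    hammingNorm (traceWord p e F u) = wordWeight p e (u.1 : F) u.2 := by
  rw [hammingNorm, wordWeight]
  refine card_bij (fun x _ => (x : F)) ?_ ?_ ?_
  · intro x hx
    simpa [traceWord] using hx
  · exact fun x _ y _ h => Subtype.ext h
  · intro x hx
    have hx' := (mem_filter.mp hx).2
    have : x ∉ primeField p F := fun h => hx' (trace_word_primeField u.1.2 u.2.2 h)
    exact ⟨⟨x, this⟩, by simpa [traceWord] using hx, rfl⟩

theorem weightCount_range_traceWord (hp : Odd p) (hme : Odd (m / m.gcd e))
    (hF : Fintype.card F = p ^ m) (w : ℕ) :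
    (weightCount (LinearMap.range (traceWord p e F)) w : ℚ) =
      ∑ a ∈ traceZero p F, ∑ b ∈ traceZero p F,
        if (wordWeight p e a b : ℤ) = w then 1 else 0 := by
  classical
  have hset : {c | c ∈ LinearMap.range (traceWord p e F) ∧ hammingNorm c = w} =
      ((univ.filter fun u => wordWeight p e (u.1 : F) (u.2 : F) = w).image (traceWord p e F) :
        Set ({x : F // x ∉ primeField p F} → ZMod p)) := by
    ext c
    simp only [coe_image, coe_filter, mem_univ, true_and, Set.mem_image, Set.mem_ofPred_eq]
    constructor
    · rintro ⟨⟨u, rfl⟩, h⟩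
      exact ⟨u, by rw [← hammingNorm_traceWord, h], rfl⟩
    · rintro ⟨u, h, rfl⟩
      exact ⟨⟨u, rfl⟩, by rw [hammingNorm_traceWord, h]⟩
  rw [weightCount, hset, Set.ncard_coe_finset, card_image_of_injective _
    (traceWord_injective hp hme hF), ← sum_product', card_filter]
  push_cast
  refine sum_bij (fun u _ => ((u.1 : F), (u.2 : F))) ?_ ?_ ?_ ?_
  · intro u _
    exact mem_product.mpr ⟨mem_traceZero.mpr u.1.2, mem_traceZero.mpr u.2.2⟩
  · intro u _ v _ h
    rw [Prod.mk.injEq] at h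
    exact Prod.ext (Subtype.ext h.1) (Subtype.ext h.2)
  · rintro ⟨a, b⟩ h
    obtain ⟨h1, h2⟩ := mem_product.mp h
    exact ⟨(⟨a, mem_traceZero.mp h1⟩, ⟨b, mem_traceZero.mp h2⟩), mem_univ _, rfl⟩
  · intro u _
    simp

omit [DecidableEq F] in
theorem wordWeight_add (a b : F) : wordWeight p e a b +
    #{x : F | Algebra.trace (ZMod p) F (a * x ^ (p ^ e + 1) + b * x) = 0} = Fintype.card F := by
  rw [wordWeight, add_comm, card_filter_add_card_filter_not, card_univ]

omit [DecidableEq F] in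
theorem mul_wordWeight_zero {b : F} (hb : b ≠ 0) :
    p * wordWeight p e 0 b + Fintype.card F = p * Fintype.card F := by
  let f := (Algebra.trace (ZMod p) F).comp (LinearMap.mulLeft (ZMod p) b)
  have hf : f ≠ 0 := fun h =>
    hb (eq_zero_of_trace_mul_eq_zero (p := p) fun y => LinearMap.congr_fun h y)
  have h := card_fiber_linearMap f hf 0
  have h2 := wordWeight_add (p := p) (e := e) 0 b
  simp only [zero_mul, zero_add] at h2
  rw [← h2, mul_add]
  congr 1
  rw [h2]
  exact h.symm

-- With `b = f y`, the word at `x` is `Q(y + x) - Q(y)`. An arbitrary `g` lets one computation serve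
-- every weight; it is later an indicator function.
omit [DecidableEq F] in
theorem sum_wordWeight (hp : Odd p) (hme : Odd (m / m.gcd e)) (hF : Fintype.card F = p ^ m)
    {a : F} (ha : a ≠ 0) (g : ℤ → ℚ) :
    ∑ b ∈ traceZero p F, g (wordWeight p e a b) =
      ∑ t, (orthogonalValueCount (traceFormOf p e a) 1 t : ℚ) *
        g (p ^ m - valueCount (traceFormOf p e a) t) := by
  classical
  obtain ⟨f, hf⟩ := exists_trace_mul_eq hp hme hF ha
  set B := traceFormOf p e a with hB
  have hmem : ∀ y, f y ∈ traceZero p F ↔ B 1 y = 0 := by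
    intro y
    have := hf y 1
    rw [mul_one] at this
    rw [mem_traceZero, this, hB, traceFormOf_comm a y 1, mul_eq_zero,
      or_iff_right (two_ne_zero_of_odd hp)]
  have hwt : ∀ y, (wordWeight p e a (f y) : ℤ) = p ^ m - valueCount B (B y y) := by
    intro y
    have h := wordWeight_add (p := p) (e := e) a (f y)
    have h1 : #{x : F | Algebra.trace (ZMod p) F (a * x ^ (p ^ e + 1) + f y * x) = 0} =
        valueCount B (B y y) := by
      have hx : ∀ x, Algebra.trace (ZMod p) F (a * x ^ (p ^ e + 1) + f y * x) = 0 ↔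
          B (y + x) (y + x) = B y y := by
        intro x
        rw [map_add, hf, ← traceFormOf_self hp, ← hB, map_add, map_add, LinearMap.add_apply,
          LinearMap.add_apply, hB, traceFormOf_comm a x y, ← sub_eq_zero (b := traceFormOf p e a y y)]
        refine Eq.congr ?_ rfl
        ring
      rw [valueCount]
      refine card_nbij' (fun x => y + x) (fun x => x - y) ?_ ?_ ?_ ?_
      · intro x hx'
        rw [mem_coe, mem_filter, hx] at hx'
        exact mem_coe.mpr (mem_filter.mpr ⟨mem_univ _, hx'.2⟩)
      · intro x hx'
        refine mem_coe.mpr (mem_filter.mpr ⟨mem_univ _, (hx _).mpr ?_⟩)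
        rw [add_sub_cancel]
        exact (mem_filter.mp (mem_coe.mp hx')).2
      · intro x _; simp
      · intro x _; simp
    rw [h1, hF] at h
    zify at h
    linarith
  have h1 : ∑ b ∈ traceZero p F, g (wordWeight p e a b) =
      ∑ y ∈ ({y | B 1 y = 0} : Finset F), g (p ^ m - valueCount B (B y y)) := by
    symm
    refine sum_bij (fun y _ => f y) ?_ ?_ ?_ ?_
    · intro y hy
      exact (hmem y).mpr (mem_filter.mp hy).2
    · exact fun x _ y _ h => f.injective h
    · intro b hb
      refine ⟨f.symm b, mem_filter.mpr ⟨mem_univ _, (hmem _).mp (by simpa using hb)⟩, by simp⟩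
    · intro y _
      rw [hwt]
  rw [h1, ← sum_fiberwise_of_maps_to (t := univ) (g := fun y => B y y) (fun _ _ => mem_univ _)]
  refine sum_congr rfl fun t _ => ?_
  rw [sum_congr rfl (g := fun _ => g (p ^ m - valueCount B t)), sum_const, nsmul_eq_mul,
    filter_filter, orthogonalValueCount]
  intro y hy
  rw [(mem_filter.mp hy).2]

end ShortenedCodes

/-! ### Summation over `a` and `b`. -/

namespace ShortenedCodes

open Finset

variable {p m e : ℕ} [Fact p.Prime] {F : Type*} [Field F] [Fintype F] [Algebra (ZMod p) F]

theorem sum_quadraticChar_comp (hp : Odd p) (g : ℤ → ℚ) :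
    ∑ t : ZMod p, g (quadraticChar (ZMod p) t) = g 0 + ((p : ℚ) - 1) / 2 * (g 1 + g (-1)) := by
  have h1 : ∑ t : ZMod p, (quadraticChar (ZMod p) t : ℚ) = 0 := by
    exact_mod_cast quadraticChar_sum_zero (ringChar_zmod_ne_two hp)
  have h2 : ∑ t : ZMod p, (quadraticChar (ZMod p) t : ℚ) ^ 2 = p - 1 := by
    exact_mod_cast sum_quadraticChar_sq (p := p)
  have h : ∀ t : ZMod p, g (quadraticChar (ZMod p) t) =
      g 0 + (quadraticChar (ZMod p) t : ℚ) * ((g 1 - g (-1)) / 2) +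
        (quadraticChar (ZMod p) t : ℚ) ^ 2 * ((g 1 + g (-1)) / 2 - g 0) := by
    intro t
    by_cases ht : t = 0
    · subst ht; simp
    · rcases quadraticChar_dichotomy ht with h | h <;> rw [h] <;> push_cast <;> ring
  rw [sum_congr rfl fun t _ => h t, sum_add_distrib, sum_add_distrib, ← sum_mul, ← sum_mul, h1, h2]
  simp [ZMod.card]
  ring

theorem sum_ite_eq_zero_zmod (x y : ℚ) :
    ∑ t : ZMod p, (if t = 0 then x else y) = x + ((p : ℚ) - 1) * y := by
  rw [← add_sum_erase _ _ (mem_univ (0 : ZMod p)), sum_congr rfl (g := fun _ => y)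
    (fun c hc => if_neg (ne_of_mem_erase hc))]
  simp [card_erase_of_mem, ZMod.card, Nat.cast_sub (Fact.out : p.Prime).one_le]

theorem sq_mul_orthogonalValueCount (hp : Odd p) (hme : Odd (m / m.gcd e))
    (hF : Fintype.card F = p ^ m) {a : F} (ha : a ≠ 0) (ha' : a ∈ traceZero p F) (t : ZMod p) :
    (p : ℤ) ^ 2 * orthogonalValueCount (traceFormOf p e a) 1 t + (p - 1) * p ^ m =
      p ^ 2 * valueCount (traceFormOf p e a) t := by
  have h := orthogonalValueCount_add hp (traceFormOf p e a) (traceFormOf_comm a) (w := 1)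
    (fun h => one_ne_zero (traceFormOf_nondegenerate hp hme hF ha 1 fun y => by simp [h]))
    (by rw [traceFormOf_self hp, one_pow, mul_one, mem_traceZero.mp ha']) t
  rw [hF] at h
  exact_mod_cast h

theorem sum_wordWeight_zero (hF : Fintype.card F = p ^ (m + 1)) (g : ℤ → ℚ) :
    ∑ b ∈ traceZero p F, g (wordWeight p e 0 b) =
      g 0 + ((p : ℚ) ^ m - 1) * g ((p : ℤ) ^ m * (p - 1)) := by
  classical
  have hp0 := (Fact.out : p.Prime).pos
  have h0 : (0 : F) ∈ traceZero p F := mem_traceZero.mpr (map_zero _)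
  have hc : #(traceZero p F) = p ^ m := by
    apply Nat.eq_of_mul_eq_mul_left hp0
    rw [card_mul_traceZero, hF, pow_succ']
  rw [← add_sum_erase _ _ h0, sum_congr rfl (g := fun _ => g ((p : ℤ) ^ m * (p - 1)))]
  · rw [sum_const, card_erase_of_mem h0, hc, nsmul_eq_mul,
      Nat.cast_sub (Nat.one_le_pow _ _ hp0)]
    simp [wordWeight]
  · intro b hb
    congr 1
    have h := mul_wordWeight_zero (p := p) (e := e) (ne_of_mem_erase hb)
    rw [hF] at h
    zify at h
    apply mul_left_cancel₀ (show (p : ℤ) ≠ 0 by exact_mod_cast hp0.ne')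
    linear_combination h

theorem card_traceZero_erase [DecidableEq F] (hF : Fintype.card F = p ^ (m + 1)) :
    (#((traceZero p F).erase 0) : ℚ) = (p : ℚ) ^ m - 1 := by
  have hp0 := (Fact.out : p.Prime).pos
  have hc : #(traceZero p F) = p ^ m := by
    apply Nat.eq_of_mul_eq_mul_left hp0
    rw [card_mul_traceZero, hF, pow_succ']
  rw [card_erase_of_mem (mem_traceZero.mpr (map_zero _)), hc,
      Nat.cast_sub (Nat.one_le_pow _ _ hp0)]
  simp

/-- The sign of the form only exchanges squares and nonsquares, which are equally many, so the
result is independent of `a`. -/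
theorem sum_wordWeight_odd {k : ℕ} (hp : Odd p) (hme : Odd ((2 * k + 1) / (2 * k + 1).gcd e))
    (hF : Fintype.card F = p ^ (2 * k + 1)) {a : F} (ha : a ≠ 0) (ha' : a ∈ traceZero p F)
    (g : ℤ → ℚ) :
    ∑ b ∈ traceZero p F, g (wordWeight p e a b) =
      (p : ℚ) ^ (2 * k) / p * g ((p : ℤ) ^ (2 * k) * (p - 1)) +
      ((p : ℚ) - 1) / 2 * (
        ((p : ℚ) ^ (2 * k) / p + p ^ k) * g ((p : ℤ) ^ (2 * k) * (p - 1) - p ^ k) +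
        ((p : ℚ) ^ (2 * k) / p - p ^ k) * g ((p : ℤ) ^ (2 * k) * (p - 1) + p ^ k)) := by
  have hp0 : (p : ℚ) ≠ 0 := by exact_mod_cast (Fact.out : p.Prime).ne_zero
  rw [sum_wordWeight hp hme hF ha]
  obtain ⟨σ, hσ, hN⟩ := valueCount_odd_dim hp (traceFormOf p e a) (traceFormOf_comm a)
    (traceFormOf_nondegenerate hp hme hF ha) hF
  have hM : ∀ t, (orthogonalValueCount (traceFormOf p e a) 1 t : ℚ) =
      (p : ℚ) ^ (2 * k) / p + σ * quadraticChar (ZMod p) t * p ^ k := by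
    intro t
    have h := sq_mul_orthogonalValueCount hp hme hF ha ha' t
    rw [hN] at h
    have h' : (p : ℚ) ^ 2 * orthogonalValueCount (traceFormOf p e a) 1 t +
        (p - 1) * p ^ (2 * k + 1) =
        p ^ 2 * (p ^ (2 * k) + σ * quadraticChar (ZMod p) t * p ^ k) := by exact_mod_cast h
    apply mul_left_cancel₀ (pow_ne_zero 2 hp0)
    rw [eq_sub_of_add_eq h']
    field_simp
    ring
  simp only [hM, hN]
  rw [sum_quadraticChar_comp hp (fun s => ((p : ℚ) ^ (2 * k) / p + σ * s * p ^ k) *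
    g (p ^ (2 * k + 1) - (p ^ (2 * k) + σ * s * p ^ k)))]
  have e0 : (p : ℤ) ^ (2 * k + 1) - (p ^ (2 * k) + σ * 0 * p ^ k) = p ^ (2 * k) * (p - 1) := by ring
  rw [e0]
  have e1 : (p : ℤ) ^ (2 * k + 1) - (p ^ (2 * k) + p ^ k) = p ^ (2 * k) * (p - 1) - p ^ k := by ring
  have e2 : (p : ℤ) ^ (2 * k + 1) - (p ^ (2 * k) + -p ^ k) = p ^ (2 * k) * (p - 1) + p ^ k := by
    ring
  rcases hσ with rfl | rfl
  · simp only [one_mul, neg_one_mul, e1, e2]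
    push_cast; ring
  · simp only [one_mul, mul_one, neg_mul, neg_neg, mul_neg, e1, e2]
    push_cast; ring

/-- The weights and their frequencies in the words with a fixed form of type `σ`, for an extension
of degree `2 * k + 2`. -/
noncomputable def evenContribution (p k : ℕ) (g : ℤ → ℚ) (σ : ℤ) : ℚ :=
  ((p : ℚ) ^ (2 * k) + σ * p ^ k * (p - 1)) *
      g ((p : ℤ) ^ (2 * k + 1) * (p - 1) - σ * p ^ k * (p - 1)) +
    (p - 1) * ((p : ℚ) ^ (2 * k) - σ * p ^ k) *
      g ((p : ℤ) ^ (2 * k + 1) * (p - 1) + σ * p ^ k)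

theorem sum_wordWeight_even {k : ℕ} (hp : Odd p) (hme : Odd ((2 * k + 2) / (2 * k + 2).gcd e))
    (hF : Fintype.card F = p ^ (2 * k + 2)) {a : F} (ha : a ≠ 0) (ha' : a ∈ traceZero p F) :
    ∃ σ : ℤ, (σ = 1 ∨ σ = -1) ∧
      (#{x : F | Algebra.trace (ZMod p) F (a * x ^ (p ^ e + 1)) = 0} : ℤ) =
        p ^ (2 * k + 1) + σ * p ^ k * (p - 1) ∧
      ∀ g : ℤ → ℚ, ∑ b ∈ traceZero p F, g (wordWeight p e a b) = evenContribution p k g σ := by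
  have hp0 : (p : ℚ) ≠ 0 := by exact_mod_cast (Fact.out : p.Prime).ne_zero
  obtain ⟨σ, hσ, hN⟩ := valueCount_even_dim hp (traceFormOf p e a) (traceFormOf_comm a)
    (traceFormOf_nondegenerate hp hme hF ha) hF
  have hM : ∀ t, (orthogonalValueCount (traceFormOf p e a) 1 t : ℚ) =
      (p : ℚ) ^ (2 * k) + σ * p ^ k * if t = 0 then (p : ℚ) - 1 else -1 := by
    intro t
    have h := sq_mul_orthogonalValueCount hp hme hF ha ha' t
    rw [hN] at h
    have h' : (p : ℚ) ^ 2 * orthogonalValueCount (traceFormOf p e a) 1 t +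
        (p - 1) * p ^ (2 * k + 2) =
        p ^ 2 * (p ^ (2 * k + 1) + σ * p ^ k * if t = 0 then (p : ℚ) - 1 else -1) := by
      exact_mod_cast h
    apply mul_left_cancel₀ (pow_ne_zero 2 hp0)
    rw [eq_sub_of_add_eq h']
    ring
  refine ⟨σ, hσ, ?_, fun g => ?_⟩
  · have := hN 0
    rw [if_pos rfl] at this
    simpa [valueCount, traceFormOf_self hp] using this
  rw [sum_wordWeight hp hme hF ha, evenContribution]
  have h : ∀ t, (orthogonalValueCount (traceFormOf p e a) 1 t : ℚ) *
      g (p ^ (2 * k + 2) - valueCount (traceFormOf p e a) t) = if t = 0 then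
        ((p : ℚ) ^ (2 * k) + σ * p ^ k * (p - 1)) *
          g ((p : ℤ) ^ (2 * k + 1) * (p - 1) - σ * p ^ k * (p - 1))
      else ((p : ℚ) ^ (2 * k) - σ * p ^ k) *
        g ((p : ℤ) ^ (2 * k + 1) * (p - 1) + σ * p ^ k) := by
    intro t
    rw [hM, hN]
    split_ifs
    · congr 2; ring
    · congr 1
      · ring
      · congr 1; ring
  rw [sum_congr rfl fun t _ => h t, sum_ite_eq_zero_zmod]
  ring

theorem sum_sum_wordWeight_odd {k : ℕ} (hp : Odd p)
    (hme : Odd ((2 * k + 1) / (2 * k + 1).gcd e))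
    (hF : Fintype.card F = p ^ (2 * k + 1)) (g : ℤ → ℚ) :
    ∑ a ∈ traceZero p F, ∑ b ∈ traceZero p F, g (wordWeight p e a b) =
      g 0 + ((p : ℚ) ^ (2 * k) - 1) * (((p : ℚ) ^ (2 * k) / p + 1) *
        g ((p : ℤ) ^ (2 * k) * (p - 1)) +
      ((p : ℚ) - 1) / 2 * (
        ((p : ℚ) ^ (2 * k) / p + p ^ k) * g ((p : ℤ) ^ (2 * k) * (p - 1) - p ^ k) +
        ((p : ℚ) ^ (2 * k) / p - p ^ k) * g ((p : ℤ) ^ (2 * k) * (p - 1) + p ^ k))) := by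
  classical
  have h0 : (0 : F) ∈ traceZero p F := mem_traceZero.mpr (map_zero _)
  rw [← add_sum_erase _ _ h0, sum_wordWeight_zero hF, sum_congr rfl fun a ha =>
    sum_wordWeight_odd hp hme hF (ne_of_mem_erase ha) (mem_of_mem_erase ha) g, sum_const,
    nsmul_eq_mul, card_traceZero_erase hF]
  ring

theorem sum_sum_wordWeight_even {k : ℕ} (hp : Odd p)
    (hme : Odd ((2 * k + 2) / (2 * k + 2).gcd e))
    (hF : Fintype.card F = p ^ (2 * k + 2)) (g : ℤ → ℚ) :
    ∑ a ∈ traceZero p F, ∑ b ∈ traceZero p F, g (wordWeight p e a b) =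
      g 0 + ((p : ℚ) ^ (2 * k + 1) - 1) * g ((p : ℤ) ^ (2 * k + 1) * (p - 1)) +
      ((p : ℚ) ^ (2 * k + 1) - 1 + (p - 1) * p ^ k) / 2 * evenContribution p k g 1 +
      ((p : ℚ) ^ (2 * k + 1) - 1 - (p - 1) * p ^ k) / 2 * evenContribution p k g (-1) := by
  classical
  have h0 : (0 : F) ∈ traceZero p F := mem_traceZero.mpr (map_zero _)
  have hex : ∀ a : F, ∃ σ : ℤ, a ∈ (traceZero p F).erase 0 → (σ = 1 ∨ σ = -1) ∧
      (#{x : F | Algebra.trace (ZMod p) F (a * x ^ (p ^ e + 1)) = 0} : ℤ) =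
        p ^ (2 * k + 1) + σ * p ^ k * (p - 1) ∧
      ∀ g : ℤ → ℚ, ∑ b ∈ traceZero p F, g (wordWeight p e a b) = evenContribution p k g σ := by
    intro a
    by_cases ha : a ∈ (traceZero p F).erase 0
    · obtain ⟨σ, h⟩ := sum_wordWeight_even hp hme hF (ne_of_mem_erase ha) (mem_of_mem_erase ha)
      exact ⟨σ, fun _ => h⟩
    -- A junk sign outside the range of summation.
    · exact ⟨0, fun h => absurd h ha⟩
  choose σ hσ using hex
  have hcard := card_traceZero_erase (p := p) hF
  have hcard' : (#((traceZero p F).erase 0) : ℤ) = (p : ℤ) ^ (2 * k + 1) - 1 := by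
    exact_mod_cast hcard
  have hp1 : (p : ℤ) - 1 ≠ 0 := by
    have := (Fact.out : p.Prime).one_lt
    omega
  have hp0 : (p : ℤ) ≠ 0 := by exact_mod_cast (Fact.out : p.Prime).ne_zero
  -- The zero count of each form is affine in its sign, so the double count yields the sum of signs;
  -- `a = 0` contributes all of `F`.
  have hsum : ∑ a ∈ (traceZero p F).erase 0, σ a = (p - 1) * (p : ℤ) ^ k := by
    have h := sum_card_trace_mul_eq_zero hp ⟨k + 1, by ring⟩ hme hF
    rw [← add_sum_erase _ _ h0, sum_congr rfl fun a ha => (hσ a ha).2.1, sum_add_distrib,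
      sum_const, nsmul_eq_mul, hcard', ← sum_mul, ← sum_mul] at h
    simp only [zero_mul, map_zero, filter_true, card_univ, hF] at h
    push_cast at h
    apply mul_left_cancel₀ (mul_ne_zero (mul_ne_zero (pow_ne_zero 2 hp0) (pow_ne_zero k hp0)) hp1)
    linear_combination h
  have hlin : ∀ a ∈ (traceZero p F).erase 0, ∑ b ∈ traceZero p F, g (wordWeight p e a b) =
      (evenContribution p k g 1 + evenContribution p k g (-1)) / 2 +
        (σ a : ℚ) * ((evenContribution p k g 1 - evenContribution p k g (-1)) / 2) := by
    intro a ha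
    rw [(hσ a ha).2.2]
    rcases (hσ a ha).1 with h | h <;> rw [h] <;> push_cast <;> ring
  have hsum' : ∑ a ∈ (traceZero p F).erase 0, (σ a : ℚ) = (p - 1) * (p : ℚ) ^ k := by
    exact_mod_cast hsum
  rw [← add_sum_erase _ _ h0, sum_wordWeight_zero hF, sum_congr rfl hlin, sum_add_distrib,
    sum_const, nsmul_eq_mul, hcard, ← sum_mul, hsum']
  ring

/-! ### Matching the signs in the tables. -/

theorem odd_sq_pow (s j : ℕ) : ∃ r, (2 * s + 1) ^ (2 * j) = 4 * r + 1 := by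
  have h : (2 * s + 1) ^ (2 * j) ≡ 1 [MOD 4] := by
    rw [pow_mul]
    have : (2 * s + 1) ^ 2 ≡ 1 [MOD 4] := by
      have : (2 * s + 1) ^ 2 = 1 + 4 * (s * (s + 1)) := by ring
      rw [this]
      simp [Nat.ModEq]
    simpa using this.pow j
  refine ⟨(2 * s + 1) ^ (2 * j) / 4, ?_⟩
  have := Nat.div_add_mod ((2 * s + 1) ^ (2 * j)) 4
  have h' : (2 * s + 1) ^ (2 * j) % 4 = 1 := h
  omega

/-- For `m` odd, `(q - 1) / 2` and `(p - 1) / 2` have the same parity, so `B` carries the sign `ε`.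
-/
theorem constB_eq (hp : Odd p) (k : ℕ) : constB p (2 * k + 1) =
    ((-1 : ℤ) ^ ((p - 1) * (2 * k + 1 + 1) / 4) : ℤ) * (p : ℚ) ^ k := by
  obtain ⟨s, rfl⟩ := hp
  obtain ⟨r, hr⟩ := odd_sq_pow s k
  have h1 : (2 * s + 1 - 1) * (2 * k + 1 + 1) / 4 = s * (k + 1) := by
    rw [Nat.add_sub_cancel, show 2 * s * (2 * k + 1 + 1) = 4 * (s * (k + 1)) by ring]
    simp
  have h2 : (2 * s + 1 - 1) * (2 * k + 1 - 1) / 4 = s * k := by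
    rw [Nat.add_sub_cancel, Nat.add_sub_cancel, show 2 * s * (2 * k) = 4 * (s * k) by ring]
    simp
  have h3 : ((2 * s + 1) ^ (2 * k + 1) - 1) / 2 = s + 2 * ((2 * s + 1) * r) := by
    rw [pow_succ, hr, show (4 * r + 1) * (2 * s + 1) = 2 * (s + 2 * ((2 * s + 1) * r)) + 1 by ring]
    simp
  rw [constB, h1, h2, h3, show (2 * k + 1 - 1) / 2 = k by simp]
  push_cast
  rw [show s + 2 * ((2 * s + 1) * r) + s * k = s * (k + 1) + 2 * ((2 * s + 1) * r) by ring, pow_add,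
    pow_mul (-1) 2]
  simp

theorem even_exponent_eq (hp : Odd p) (k : ℕ) :
    (p - 1) * (2 * k + 2) / 4 = (2 * k + 2) * (p - 1) / 4 ∧
    ((2 * k + 2) * (p - 1) + 4) / 4 = (2 * k + 2) * (p - 1) / 4 + 1 ∧
    Odd ((p ^ (2 * k + 2) + 1) / 2) := by
  obtain ⟨s, rfl⟩ := hp
  obtain ⟨r, hr⟩ := odd_sq_pow s (k + 1)
  refine ⟨by rw [mul_comm], by omega, r, ?_⟩
  rw [show 2 * k + 2 = 2 * (k + 1) by ring, hr]
  omega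

theorem hasWeightTable_iff {ι : Type*} [Fintype ι] (C : Submodule (ZMod p) (ι → ZMod p))
    (table : List (ℤ × ℚ)) : HasWeightTable C table ↔ ∀ w : ℕ, (weightCount C w : ℚ) =
      (table.map fun row => row.2 * if row.1 = (w : ℤ) then 1 else 0).sum := by
  unfold HasWeightTable
  refine forall_congr' fun w => Eq.congr rfl ?_
  induction table with
  | nil => rfl
  | cons row l ih =>
    rw [List.filter_cons, List.map_cons, List.sum_cons, ← ih]
    split_ifs <;> simp_all

variable [DecidableEq F]

theorem hasWeightTable_odd {k : ℕ} (hp : Odd p) (hme : Odd ((2 * k + 1) / (2 * k + 1).gcd e))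
    (hF : Fintype.card F = p ^ (2 * k + 1)) :
    HasWeightTable (LinearMap.range (traceWord p e F)) (tableOdd p (2 * k + 1)) := by
  rw [hasWeightTable_iff]
  intro w
  have hp0 : (p : ℚ) ≠ 0 := by exact_mod_cast (Fact.out : p.Prime).ne_zero
  rw [weightCount_range_traceWord hp hme hF,
    sum_sum_wordWeight_odd hp hme hF (fun z => if z = (w : ℤ) then 1 else 0), tableOdd,
    constB_eq hp]
  have hz : (p : ℚ) ^ (((2 * k + 1 : ℕ) : ℤ) - 2) = (p : ℚ) ^ (2 * k) / p := by
    rw [show (((2 * k + 1 : ℕ) : ℤ) - 2) = ((2 * k : ℕ) : ℤ) - 1 by push_cast; ring,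
      zpow_sub_one₀ hp0, zpow_natCast, div_eq_mul_inv]
  rw [hz, Nat.add_sub_cancel, Nat.mul_div_cancel_left k two_pos]
  generalize (p - 1) * (2 * k + 1 + 1) / 4 = n
  simp only [List.map_cons, List.map_nil, List.sum_cons, List.sum_nil]
  -- Changing the sign `ε` merely swaps the last two rows.
  rcases neg_one_pow_eq_or ℤ n with h | h <;> rw [h]
  · simp only [mul_one]
    push_cast
    ring
  · simp only [mul_neg, mul_one, sub_neg_eq_add, ← sub_eq_add_neg]
    push_cast
    ring

theorem hasWeightTable_even {k : ℕ} (hp : Odd p) (hme : Odd ((2 * k + 2) / (2 * k + 2).gcd e))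
    (hF : Fintype.card F = p ^ (2 * k + 2)) :
    HasWeightTable (LinearMap.range (traceWord p e F)) (tableEven p (2 * k + 2)) := by
  rw [hasWeightTable_iff]
  intro w
  rw [weightCount_range_traceWord hp hme hF,
    sum_sum_wordWeight_even hp hme hF (fun z => if z = (w : ℤ) then 1 else 0), tableEven,
    constB₁, constB₂, evenContribution, evenContribution]
  obtain ⟨h1, h2, h3⟩ := even_exponent_eq hp k
  have h4 : (2 * k + 2 - 1) = 2 * k + 1 := by omega
  rw [h1, h2, pow_add (-1 : ℚ), h3.neg_one_pow, h4, Nat.add_sub_cancel,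
    Nat.mul_div_cancel_left k two_pos, pow_succ (-1 : ℤ)]
  generalize (2 * k + 2) * (p - 1) / 4 = n
  have hq : (-1 : ℚ) ^ n = (((-1 : ℤ) ^ n : ℤ) : ℚ) := by push_cast; rfl
  rw [hq]
  simp only [List.map_cons, List.map_nil, List.sum_cons, List.sum_nil]
  have e1 : (p : ℤ) ^ k * (p - 1) = (p - 1) * p ^ k := mul_comm _ _
  -- `B₁` counts the `a` with `σ = -δ`; changing `δ` swaps the rows of the two signs.
  rcases neg_one_pow_eq_or ℤ n with h | h <;> rw [h] <;>
  · simp only [mul_neg, neg_mul, mul_one, one_mul, sub_neg_eq_add, neg_neg, ← sub_eq_add_neg, e1]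
    push_cast
    ring

end ShortenedCodes

theorem mainTheorem5 (p m e : ℕ) [Fact p.Prime] (hp : Odd p) (hm : 0 < m) (he : 0 < e)
    (hme : Odd (m / Nat.gcd m e))
    (F : Type*) [Field F] [Fintype F] [DecidableEq F] [Algebra (ZMod p) F]
    (hF : Fintype.card F = p ^ m) :
    let C : Submodule (ZMod p) (F → ZMod p) :=
      ShortenedCodes.traceCode (ZMod p) (Polynomial.X ^ (p ^ e + 1) : Polynomial F)
    let CT := ShortenedCodes.shortenedCode C (ShortenedCodes.primeField p F)
    ShortenedCodes.codeLength CT = p ^ m - p ∧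
    Module.finrank (ZMod p) CT = 2 * m - 2 ∧
    (Odd m → ShortenedCodes.HasWeightTable CT (ShortenedCodes.tableOdd p m)) ∧
    (Even m → ShortenedCodes.HasWeightTable CT (ShortenedCodes.tableEven p m)) := by
  intro C CT
  have hCT : CT = LinearMap.range (ShortenedCodes.traceWord p e F) :=
    ShortenedCodes.shortenedCode_eq_range hp
  refine ⟨?_, ?_, ?_, ?_⟩
  · have h : (ShortenedCodes.primeField p F).card = p := by
      rw [ShortenedCodes.primeField, Finset.card_image_of_injective _
        (algebraMap (ZMod p) F).injective, Finset.card_univ, ZMod.card]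
    rw [ShortenedCodes.codeLength, Fintype.card_subtype_compl, Fintype.card_coe, h, hF]
  · rw [hCT, LinearMap.finrank_range_of_inj (ShortenedCodes.traceWord_injective hp hme hF),
      Module.finrank_prod, ShortenedCodes.finrank_ker_trace hF]
    omega
  · rintro ⟨k, rfl⟩
    rw [hCT]
    exact ShortenedCodes.hasWeightTable_odd hp hme hF
  · rintro ⟨k, rfl⟩
    obtain ⟨j, rfl⟩ : ∃ j, k = j + 1 := ⟨k - 1, by omega⟩
    have hj : j + 1 + (j + 1) = 2 * j + 2 := by ring
    rw [hj] at hme hF ⊢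
    rw [hCT]
    exact ShortenedCodes.hasWeightTable_even hp hme hF
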